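/- Let $S$ be a semigroup which is a disjoint union of finitely many subsemigroups $N_1,\dots,N_n$, each isomorphic to the free monogenic semigroup (the positive integers under addition). Then $S$ is finitely generated and has soluble subsemigroup membership problem. That is, for every finite generating family $g$ of $S$, there is an algorithm which takes as input a finite list $y_1,\dots,y_k$ of nonempty words over $g$ and a nonempty word $x$ over $g$, and decides whether the element of $S$ represented by $x$ lies in the subsemigroup of $S$ generated by the elements represented by $y_1,\dots,y_k$. -/

import Mathlib

/-- `S` is the disjoint union of finitely many subsemigroups, each of them isomorphic to the free
monogenic semigroup, that is, to the positive integers under addition. -/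
def IsFiniteDisjointUnionOfFreeMonogenic (S : Type*) [Semigroup S] : Prop :=
  ∃ (n : ℕ) (N : Fin n → Subsemigroup S),
    (∀ i, Nonempty (N i ≃* Multiplicative ℕ+)) ∧
    (∀ i j, i ≠ j → Disjoint (N i : Set S) (N j : Set S)) ∧
    (⋃ i, (N i : Set S)) = Set.univ

/-- Nonempty words over the alphabet `Fin n`, stored as first letter and remaining letters. This is
the type underlying `FreeSemigroup (Fin n)`, written as a product so that Mathlib's coding of pairs
and lists applies to it. -/
abbrev NEWord (n : ℕ) : Type := Fin n × List (Fin n)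

/-- The element of `S` represented by a nonempty word, where the letter `i` stands for `g i`. -/
def NEWord.eval {S : Type*} [Semigroup S] {n : ℕ} (g : Fin n → S) (w : NEWord n) : S :=
  FreeSemigroup.lift g ⟨w.1, w.2⟩

/-- `S` is finitely generated and, for every finite generating family `g` of `S`, there is an
algorithm which, given a finite list `Y` of nonempty words and a nonempty word `x` over `g`, decides
whether the element represented by `x` lies in the subsemigroup generated by the elements
represented by the words in `Y`. -/
def HasSolubleSubsemigroupMembership (S : Type*) [Semigroup S] : Prop :=
  (∃ (n : ℕ) (g : Fin n → S), Subsemigroup.closure (Set.range g) = ⊤) ∧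
  ∀ (n : ℕ) (g : Fin n → S), Subsemigroup.closure (Set.range g) = ⊤ →
    ComputablePred fun p : List (NEWord n) × NEWord n =>
      NEWord.eval g p.2 ∈ Subsemigroup.closure {s : S | ∃ y ∈ p.1, NEWord.eval g y = s}

open Filter

/-! Adjoin a unit to $S$ and let $c_i$ generate $N_i$, so that every element of $S$ is coded by a
component and a positive exponent. The key fact, `le_of_mul_pow_eq`, is that a translation returning
a power of $c_i$ to the same component cannot lower its exponent; otherwise $S$ would contain an
idempotent. Hence the components of $a^j x$ are eventually periodic in $j$, and along a period the
exponents grow linearly (`exists_linear_code`, `eventually_component_eq`). So multiplication by a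
fixed generator is given by a finite table of values and slopes, and is primitive recursive on codes
(`exists_primrec_step`).

Membership is semidecided by searching for a product of the $y$'s. For non-membership, a
subsemigroup $T$ meets each $N_i$ in an additively closed set of exponents, which is eventually
periodic; thus $T$ is described by finite data modulo some index and period. Whether such data
contain the $y$'s, are stable under right multiplication by them and omit $x$ is a finite check
(`Separates`). Non-membership is therefore semidecidable too, and Post's theorem gives decidability.
-/

/-- In the monoid `M`, every element other than `1` is a positive power of exactly one of the
elements `c 0, …, c (n - 1)`, with a unique exponent, and `M` has no units other than `1`. -/
structure MonogenicCover {M : Type*} [Monoid M] (n : ℕ) (c : ℕ → M) : Prop where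
  exists_pow : ∀ x : M, x ≠ 1 → ∃ i < n, ∃ j, 1 ≤ j ∧ c i ^ j = x
  pow_inj : ∀ {i k j l : ℕ}, i < n → k < n → 1 ≤ j → c i ^ j = c k ^ l → i = k ∧ j = l
  mul_ne_one_left : ∀ x y : M, x ≠ 1 → x * y ≠ 1
  mul_ne_one_right : ∀ x y : M, y ≠ 1 → x * y ≠ 1

/-! ### Exponents, components and their behaviour under translation. -/

namespace MonogenicCover

variable {M : Type*} [Monoid M] {n : ℕ} {c : ℕ → M}

theorem pow_ne_one (C : MonogenicCover n c) {i j : ℕ} (hi : i < n) (hj : 1 ≤ j) :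
    c i ^ j ≠ 1 := by
  intro h
  have := (C.pow_inj (l := 0) hi hi hj (by simpa using h)).2
  omega

theorem pow_injective (C : MonogenicCover n c) {i j l : ℕ} (hi : i < n)
    (h : c i ^ j = c i ^ l) : j = l := by
  rcases Nat.eq_zero_or_pos j with rfl | hj
  · rcases Nat.eq_zero_or_pos l with rfl | hl
    · rfl
    · exact absurd (by simpa using h.symm) (C.pow_ne_one hi hl)
  · exact (C.pow_inj hi hi hj h).2

theorem mul_self_ne (C : MonogenicCover n c) {x : M} (hx : x ≠ 1) : x * x ≠ x := by
  obtain ⟨i, hi, j, hj, rfl⟩ := C.exists_pow x hx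
  intro h
  rw [← pow_add] at h
  have := C.pow_injective hi h
  omega

/-- Among infinitely many elements other than `1`, two have a common power. -/
theorem exists_lt_pow_eq (C : MonogenicCover n c) (x : ℕ → M) (hx : ∀ j, x j ≠ 1) :
    ∃ j l p q, j < l ∧ 1 ≤ p ∧ 1 ≤ q ∧ x j ^ p = x l ^ q := by
  choose f hf e he hfe using fun j => C.exists_pow (x j) (hx j)
  obtain ⟨j, l, hjl, h⟩ := Finite.exists_ne_map_eq_of_infinite (fun j => (⟨f j, hf j⟩ : Fin n))
  have h' : f j = f l := by simpa using h
  have key : x j ^ e l = x l ^ e j := by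
    rw [← hfe j, ← hfe l, h', ← pow_mul, ← pow_mul, mul_comm]
  rcases lt_or_gt_of_ne hjl with hlt | hlt
  · exact ⟨j, l, _, _, hlt, he l, he j, key⟩
  · exact ⟨l, j, _, _, hlt, he j, he l, key.symm⟩

/-- Multiplication by an element cannot lower exponents within one component. -/
theorem le_of_mul_pow_eq (C : MonogenicCover n c) {i r s : ℕ} (hi : i < n) {α : M}
    (h : α * c i ^ r = c i ^ s) : r ≤ s := by
  -- If $r = s + d$, then $\alpha$ cancels $b^d$ on high powers of $b$, as in the bicyclic monoid,
  -- where all $b^{jd}\alpha^j$ are idempotent. Two such elements, suitably padded, must have a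
  -- common power, and this collapse produces an actual idempotent.
  by_contra! hsr
  obtain ⟨d, hd, rfl⟩ : ∃ d, 1 ≤ d ∧ r = s + d := ⟨r - s, by omega, by omega⟩
  set b := c i with hb
  have h1 : ∀ u, s ≤ u → α * b ^ (u + d) = b ^ u := by
    intro u hu
    obtain ⟨t, rfl⟩ := Nat.exists_eq_add_of_le hu
    rw [show s + t + d = s + d + t by ring, pow_add b (s + d), ← mul_assoc, h, ← pow_add]
  have h2 : ∀ k u, s ≤ u → α ^ k * b ^ (u + k * d) = b ^ u := by
    intro k
    induction k with
    | zero => simp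
    | succ k ih =>
      intro u hu
      rw [pow_succ, mul_assoc, show u + (k + 1) * d = (u + k * d) + d by ring,
        h1 _ (by omega), ih u hu]
  have hne : ∀ v y, 1 ≤ v → b ^ v * y ≠ 1 := fun v y hv =>
    C.mul_ne_one_left _ _ (C.pow_ne_one hi hv)
  -- The padding $s + d$ leaves enough powers of $b$ for each inner $\alpha^j$ to cancel.
  have hpow : ∀ j p, (b ^ (s + d + j * d) * α ^ j) ^ (p + 1)
      = b ^ (j * d + (p + 1) * (s + d)) * α ^ j := by
    intro j p
    induction p with
    | zero => rw [pow_one]; congr 2; ring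
    | succ p ih =>
      rw [pow_succ', ih, mul_assoc, ← mul_assoc (α ^ j),
        show j * d + (p + 1) * (s + d) = (p + 1) * (s + d) + j * d by ring,
        h2 j _ (by nlinarith), ← mul_assoc, ← pow_add]
      congr 2; ring
  obtain ⟨j, l, p, q, hjl, hp, hq, hpq⟩ := C.exists_lt_pow_eq
    (fun j => b ^ (s + d + j * d) * α ^ j) (fun j => hne _ _ (by omega))
  obtain ⟨p, rfl⟩ := Nat.exists_eq_add_of_le' hp
  obtain ⟨q, rfl⟩ := Nat.exists_eq_add_of_le' hq
  simp only [hpow] at hpq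
  have hpq' : p = q := by
    -- This right factor is long enough to absorb both $\alpha^j$ and $\alpha^l$, leaving pure
    -- powers of $b$.
    have h3 := congrArg (· * b ^ (s + (j + l) * d)) hpq
    simp only [mul_assoc] at h3
    rw [show s + (j + l) * d = (s + l * d) + j * d by ring, h2 j _ (by omega),
      show (s + l * d) + j * d = (s + j * d) + l * d by ring, h2 l _ (by omega),
      ← pow_add, ← pow_add] at h3
    have h4 := C.pow_injective hi h3
    have h5 : (p + 1) * (s + d) = (q + 1) * (s + d) := by linarith
    have := Nat.eq_of_mul_eq_mul_right (by omega) h5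
    omega
  subst hpq'
  obtain ⟨W, hW⟩ : ∃ W, W = (p + 1) * (s + d) := ⟨_, rfl⟩
  have hW1 : 1 ≤ W := by rw [hW]; exact Nat.mul_pos (by omega) (by omega)
  rw [← hW] at hpq
  obtain ⟨δ, hδ, rfl⟩ : ∃ δ, 1 ≤ δ ∧ l = j + δ := ⟨l - j, by omega, by omega⟩
  -- Multiplying by $b^{\delta d}$ on the left and $\alpha^\delta$ on the right repeats the
  -- collision.
  have hE : ∀ k, b ^ (j * d + W + k * δ * d) * α ^ (j + k * δ) = b ^ (j * d + W) * α ^ j := by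
    intro k
    induction k with
    | zero => simp
    | succ k ih =>
      have e1 : j * d + W + (k + 1) * δ * d = k * δ * d + ((j + δ) * d + W) := by ring
      have e2 : j + (k + 1) * δ = (j + δ) + k * δ := by ring
      calc _ = b ^ (k * δ * d) * (b ^ ((j + δ) * d + W) * α ^ (j + δ)) * α ^ (k * δ) := by
            rw [e1, e2, pow_add, pow_add α]; simp only [mul_assoc]
        _ = b ^ (k * δ * d) * (b ^ (j * d + W) * α ^ j) * α ^ (k * δ) := by rw [hpq]
        _ = b ^ (j * d + W + k * δ * d) * α ^ (j + k * δ) := by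
            rw [add_comm (j * d + W), pow_add b (k * δ * d), pow_add α]; simp only [mul_assoc]
        _ = _ := ih
  obtain ⟨d, rfl⟩ := Nat.exists_eq_add_of_le' hd
  -- The element on the left will be idempotent. On the right it has a surplus of at least $s$
  -- powers of $b$, so in its square the $\alpha^{j+W}$ of the first factor cancels into the second.
  have hy : b ^ ((j + W) * (d + 1)) * α ^ (j + W)
      = b ^ ((s + (d + 1)) * δ * (d + 1) + (j + W) * (d + 1))
        * α ^ (j + W + (s + (d + 1)) * δ) := by
    have e1 : (j + W) * (d + 1) = W * d + (j * (d + 1) + W) := by ring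
    have e2 : (s + (d + 1)) * δ * (d + 1) + (j + W) * (d + 1)
      = W * d + (j * (d + 1) + W + (s + (d + 1)) * δ * (d + 1)) := by ring
    have e3 : j + W + (s + (d + 1)) * δ = j + (s + (d + 1)) * δ + W := by ring
    rw [e2, e3, e1, pow_add, pow_add α, pow_add b (W * d), pow_add α, mul_assoc, mul_assoc,
      ← mul_assoc (b ^ _) (α ^ _) (α ^ W), ← mul_assoc (b ^ _) (α ^ _) (α ^ W), hE]
  refine C.mul_self_ne (hne ((j + W) * (d + 1)) (α ^ (j + W))
    (Nat.mul_pos (by omega) (by omega))) ?_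
  have hs : s ≤ (s + (d + 1)) * δ * (d + 1) := by
    calc s ≤ s + (d + 1) := by omega
      _ ≤ (s + (d + 1)) * δ := Nat.le_mul_of_pos_right _ hδ
      _ ≤ _ := Nat.le_mul_of_pos_right _ (by omega)
  conv_lhs => rw [hy]
  nth_rewrite 1 [← hy]
  rw [mul_assoc, ← mul_assoc (α ^ _), h2 (j + W) _ hs, ← mul_assoc, ← pow_add, hy]
  congr 2
  ring

/-- If multiplying by `a ^ q` once stays in a component, then iterating it moves along that
component in constant steps. -/
theorem exists_linear (C : MonogenicCover n c) {i r s p q : ℕ} (hi : i < n) {a x : M}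
    (h1 : a ^ p * x = c i ^ r) (h2 : a ^ (p + q) * x = c i ^ s) :
    ∃ D, s = r + D ∧ ∀ k, a ^ (p + k * q) * x = c i ^ (r + k * D) := by
  have h3 : a ^ q * c i ^ r = c i ^ s := by
    rw [← h1, ← mul_assoc, ← pow_add, add_comm, h2]
  obtain ⟨D, rfl⟩ := Nat.exists_eq_add_of_le (C.le_of_mul_pow_eq hi h3)
  refine ⟨D, rfl, fun k => ?_⟩
  induction k with
  | zero => simpa using h1
  | succ k ih =>
    rw [show p + (k + 1) * q = q + (p + k * q) by ring, pow_add, mul_assoc, ih, pow_add,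
      ← mul_assoc, h3, ← pow_add]
    congr 1; ring

/-- The component and exponent of an element, with the value `(0, 0)` at `1`. -/
noncomputable def code (n : ℕ) (c : ℕ → M) (x : M) : ℕ × ℕ :=
  open Classical in
  if h : ∃ s : ℕ × ℕ, s.1 < n ∧ 1 ≤ s.2 ∧ c s.1 ^ s.2 = x then h.choose else (0, 0)

theorem code_spec (C : MonogenicCover n c) {x : M} (hx : x ≠ 1) :
    (code n c x).1 < n ∧ 1 ≤ (code n c x).2 ∧ c (code n c x).1 ^ (code n c x).2 = x := by
  have h : ∃ s : ℕ × ℕ, s.1 < n ∧ 1 ≤ s.2 ∧ c s.1 ^ s.2 = x := by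
    obtain ⟨i, hi, j, hj, e⟩ := C.exists_pow x hx
    exact ⟨(i, j), hi, hj, e⟩
  rw [code, dif_pos h]
  exact h.choose_spec

theorem code_pow (C : MonogenicCover n c) {i j : ℕ} (hi : i < n) (hj : 1 ≤ j) :
    code n c (c i ^ j) = (i, j) := by
  have h := C.code_spec (C.pow_ne_one hi hj)
  have h' := C.pow_inj h.1 hi h.2.1 h.2.2
  exact Prod.ext h'.1 h'.2

theorem exists_linear_code (C : MonogenicCover n c) {p q : ℕ} {a x : M} (hx : x ≠ 1)
    (h : (code n c (a ^ (p + q) * x)).1 = (code n c (a ^ p * x)).1) :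
    ∃ D, ∀ k, code n c (a ^ (p + k * q) * x) =
      ((code n c (a ^ p * x)).1, (code n c (a ^ p * x)).2 + k * D) := by
  have hp := C.code_spec (C.mul_ne_one_right (a ^ p) x hx)
  have hpq := C.code_spec (C.mul_ne_one_right (a ^ (p + q)) x hx)
  rw [h] at hpq
  obtain ⟨D, -, hD⟩ := C.exists_linear hp.1 hp.2.2.symm hpq.2.2.symm
  refine ⟨D, fun k => ?_⟩
  rw [hD k, C.code_pow hp.1 (by omega)]

/-- The components met by `a ^ j * x` are eventually periodic in `j`. -/
theorem eventually_component_eq (C : MonogenicCover n c) (a : M) {x : M} (hx : x ≠ 1) :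
    ∀ᶠ N in atTop, ∀ j ≥ N,
      (code n c (a ^ (j + N.factorial) * x)).1 = (code n c (a ^ j * x)).1 := by
  set κ : ℕ → ℕ := fun j => (code n c (a ^ j * x)).1 with hκ
  have key : ∀ e : Fin n, ∀ᶠ N in atTop, ∀ j ≥ N, κ j = e → κ (j + N.factorial) = e := by
    intro e
    by_cases h : ∃ j, κ j = e
    · classical
      set p := Nat.find h with hp
      have hpe : κ p = e := Nat.find_spec h
      by_cases h' : ∃ q, 1 ≤ q ∧ κ (p + q) = e
      · obtain ⟨q, hq, hqe⟩ := h'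
        -- As exponents do not fall, a later hit of $e$ is $a^p x$ times a power of $c_e$ on the
        -- right, which commutes with the left translation by $a^q$.
        have hstep : ∀ j, κ j = e → κ (j + q) = e := by
          intro j hj
          have hpj : p ≤ j := Nat.find_min' h hj
          obtain ⟨t, rfl⟩ := Nat.exists_eq_add_of_le hpj
          have s0 := C.code_spec (C.mul_ne_one_right (a ^ p) x hx)
          have s1 := C.code_spec (C.mul_ne_one_right (a ^ (p + t)) x hx)
          have s2 := C.code_spec (C.mul_ne_one_right (a ^ (p + q)) x hx)
          simp only [hκ] at hpe hqe hj
          rw [hpe] at s0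
          rw [hj] at s1
          rw [hqe] at s2
          obtain ⟨D, hD, -⟩ := C.exists_linear s0.1 s0.2.2.symm s2.2.2.symm
          obtain ⟨E, hE, -⟩ := C.exists_linear s0.1 s0.2.2.symm s1.2.2.symm
          have h4 : a ^ (p + t + q) * x
              = c e ^ ((code n c (a ^ (p + q) * x)).2 + E) := by
            calc a ^ (p + t + q) * x = a ^ q * (a ^ (p + t) * x) := by
                  rw [← mul_assoc, ← pow_add, add_comm q]
              _ = a ^ q * (a ^ p * x * c e ^ E) := by
                  rw [← s1.2.2, hE, pow_add, s0.2.2]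
              _ = a ^ (p + q) * x * c e ^ E := by
                  rw [add_comm p q, pow_add]; simp only [mul_assoc]
              _ = _ := by rw [pow_add (c e), s2.2.2]
          simp only [hκ]
          rw [h4, C.code_pow e.2 (by omega)]
        have hmul : ∀ k j, κ j = e → κ (j + k * q) = e := by
          intro k
          induction k with
          | zero => intro j hj; simpa using hj
          | succ k ih =>
            intro j hj
            have := hstep _ (ih j hj)
            rwa [show j + (k + 1) * q = j + k * q + q by ring]
        filter_upwards [eventually_ge_atTop q] with N hN j _ hj
        obtain ⟨k, hk⟩ := Nat.dvd_factorial hq hN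
        rw [hk, mul_comm]
        exact hmul k j hj
      · filter_upwards [eventually_gt_atTop p] with N hN j hjN hj
        exact absurd ⟨j - p, by omega, by rwa [Nat.add_sub_cancel' (by omega)]⟩ h'
    · exact Eventually.of_forall fun N j _ hj => absurd ⟨j, hj⟩ h
  filter_upwards [eventually_all.2 key] with N hN j hj
  exact hN ⟨κ j, (C.code_spec (C.mul_ne_one_right (a ^ j) x hx)).1⟩ j hj rfl

end MonogenicCover

/-! ### Reduction of exponents to an index and a period. -/

/-- The representative of `j` modulo the congruence on `ℕ` with index `P` and period `Q`. -/
def reduceExponent (P Q j : ℕ) : ℕ := if j < P then j else P + (j - P) % Q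

theorem reduceExponent_add_mul {P Q j : ℕ} (hj : P ≤ j) (m : ℕ) :
    reduceExponent P Q (j + Q * m) = reduceExponent P Q j := by
  rw [reduceExponent, reduceExponent, if_neg (by omega), if_neg (by omega),
    Nat.sub_add_comm hj, Nat.add_mul_mod_self_left]

theorem reduceExponent_add_dvd {P Q j m : ℕ} (hj : P ≤ j) (h : Q ∣ m) :
    reduceExponent P Q (j + m) = reduceExponent P Q j := by
  obtain ⟨k, rfl⟩ := h
  exact reduceExponent_add_mul hj k

theorem reduceExponent_lt {P Q : ℕ} (hQ : 0 < Q) (j : ℕ) : reduceExponent P Q j < P + Q := by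
  rw [reduceExponent]
  split_ifs
  · omega
  · have := Nat.mod_lt (j - P) hQ
    omega

theorem exists_eq_reduceExponent_add (P Q j : ℕ) :
    ∃ k, j = reduceExponent P Q j + Q * k ∧ (P ≤ reduceExponent P Q j ∨ k = 0) := by
  rw [reduceExponent]
  split_ifs with h
  · exact ⟨0, by simp⟩
  · refine ⟨(j - P) / Q, ?_, Or.inl (by omega)⟩
    have := Nat.mod_add_div (j - P) Q
    omega

/-- Classes below the index are singletons, so there $D = 0$; above it, $Q$ divides $D$. -/
theorem reduceExponent_add_step {P Q r D : ℕ}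
    (h : reduceExponent P Q (r + D) = reduceExponent P Q r) (k : ℕ) :
    reduceExponent P Q (r + k * D) = reduceExponent P Q r := by
  rcases Nat.eq_zero_or_pos D with rfl | hD
  · simp
  by_cases hr : P ≤ r
  · have hdvd : Q ∣ D := by
      rw [reduceExponent, reduceExponent, if_neg (by omega), if_neg (by omega)] at h
      have h' : (r - P + D) % Q = (r - P) % Q := by
        rw [← Nat.sub_add_comm hr]; omega
      have := (Nat.modEq_iff_dvd' (Nat.le_add_right (r - P) D)).1 h'.symm
      simpa using this
    exact reduceExponent_add_dvd hr (hdvd.mul_left k)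
  · rw [reduceExponent, reduceExponent, if_pos (by omega : r < P)] at h
    split_ifs at h <;> omega

/-- The component of a coded element together with its reduced exponent. -/
def reduceCode (P Q : ℕ) (s : ℕ × ℕ) : ℕ × ℕ := (s.1, reduceExponent P Q s.2)

namespace MonogenicCover

variable {M : Type*} [Monoid M] {n : ℕ} {c : ℕ → M}

/-- Along a period of the components the exponent is affine. With slope zero it is constant;
otherwise $P$ periods bring it past the index, and a number of periods divisible by $Q$ is then
invisible after reduction. -/
theorem eventually_reduceCode_eq (C : MonogenicCover n c) (a : M) {x : M} (hx : x ≠ 1)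
    (P : ℕ) {Q : ℕ} (hQ : 0 < Q) :
    ∀ᶠ N in atTop, ∀ j ≥ N, reduceCode P Q (code n c (a ^ (j + N.factorial) * x)) =
      reduceCode P Q (code n c (a ^ j * x)) := by
  obtain ⟨N₀, hN₀⟩ := (C.eventually_component_eq a hx).exists
  set q := N₀.factorial with hq
  have hq0 : 0 < q := Nat.factorial_pos _
  filter_upwards [eventually_ge_atTop (N₀ + P * q), eventually_ge_atTop (Q * q)]
    with N hN hN' j hj
  obtain ⟨m, hm⟩ := Nat.dvd_factorial (Nat.mul_pos hQ hq0) hN'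
  obtain ⟨t, rfl⟩ := Nat.exists_eq_add_of_le (hN.trans hj)
  obtain ⟨D, hD⟩ := C.exists_linear_code hx (hN₀ (N₀ + t) (by omega))
  have e1 : N₀ + P * q + t = N₀ + t + P * q := by ring
  have e2 : N₀ + t + P * q + Q * q * m = N₀ + t + (P + Q * m) * q := by ring
  rw [hm, e1, e2, hD, hD]
  simp only [reduceCode, Prod.mk.injEq, true_and]
  rcases Nat.eq_zero_or_pos D with rfl | hD0
  · simp
  · rw [add_mul, ← add_assoc, mul_assoc]
    exact reduceExponent_add_mul
      ((Nat.le_mul_of_pos_right P hD0).trans (Nat.le_add_left _ _)) _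

end MonogenicCover

/-- A set of natural numbers closed under addition is eventually
periodic. -/
theorem eventually_mem_add_factorial_iff (A : Set ℕ)
    (hA : ∀ j ∈ A, ∀ k ∈ A, j + k ∈ A) :
    ∀ᶠ N in atTop, ∀ j ≥ N, (j ∈ A ↔ j + N.factorial ∈ A) := by
  by_cases h : ∃ m ∈ A, 0 < m
  · obtain ⟨m, hm, hm0⟩ := h
    have hmul : ∀ k, ∀ j ∈ A, j + m * k ∈ A := by
      intro k
      induction k with
      | zero => intro j hj; simpa using hj
      | succ k ih => intro j hj; rw [mul_add, ← add_assoc, mul_one]; exact hA _ (ih j hj) _ hm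
    -- Within a residue class mod $m$ the set is closed under adding $m$, so it is empty or contains
    -- everything from its first member on.
    have key : ∀ r : Fin m, ∀ᶠ N in atTop, ∀ j ≥ N, j % m = r → ∀ k, j + m * k ∈ A → j ∈ A := by
      intro r
      by_cases h : ∃ u ∈ A, u % m = r
      · obtain ⟨u, hu, hur⟩ := h
        filter_upwards [eventually_ge_atTop u] with N hN j hj hjr k _
        obtain ⟨v, hv⟩ := (Nat.modEq_iff_dvd' (hN.trans hj)).1 (hur.trans hjr.symm)
        have := hmul v u hu
        rwa [← hv, Nat.add_sub_cancel' (hN.trans hj)] at this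
      · refine Eventually.of_forall fun N j _ hjr k hk => absurd ⟨_, hk, ?_⟩ h
        rw [Nat.add_mul_mod_self_left, hjr]
    filter_upwards [eventually_all.2 key, eventually_ge_atTop m] with N hN hNm j hj
    obtain ⟨k, hk⟩ := Nat.dvd_factorial hm0 hNm
    rw [hk]
    exact ⟨hmul k j, hN ⟨j % m, Nat.mod_lt _ hm0⟩ j hj rfl k⟩
  · push Not at h
    filter_upwards [eventually_ge_atTop 1] with N hN j hj
    constructor
    · intro hj'
      have := h _ hj'
      omega
    · intro hj'
      have := h _ hj'
      omega

/-! ### Computability tools and the computation of right multiplication. -/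

theorem REPred.exists_of_primrecPred {α γ : Type*} [Primcodable α] [Primcodable γ]
    {R : α × γ → Prop} (hR : PrimrecPred R) : REPred fun a => ∃ z, R (a, z) := by
  classical
  have hf : Computable₂ fun (a : α) (k : ℕ) =>
      (Encodable.decode (α := γ) k).bind fun z => if R (a, z) then some () else none := by
    refine Primrec₂.to_comp (Primrec.option_bind (Primrec.decode.comp Primrec.snd) ?_)
    exact Primrec.ite (hR.comp (Primrec.pair (Primrec.fst.comp Primrec.fst) Primrec.snd))
      (Primrec.const _) (Primrec.const _)
  refine (Partrec.rfindOpt hf).dom_re.of_eq fun a => ?_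
  rw [Nat.rfindOpt_dom]
  constructor
  · rintro ⟨k, u, hu⟩
    obtain ⟨z, -, hz⟩ := Option.bind_eq_some_iff.1 hu
    exact ⟨z, by by_contra h; simp [h] at hz⟩
  · rintro ⟨z, hz⟩
    exact ⟨Encodable.encode z, (), by simp [hz]⟩

theorem primrecRel_mem_list {α : Type*} [Primcodable α] :
    PrimrecRel fun (a : α) (l : List α) => a ∈ l := by
  classical
  have h := (PrimrecRel.exists_mem_list (R := fun a b : α => a = b) Primrec.eq)
  refine PrimrecPred.of_eq (p := fun x : α × List α => ∃ b ∈ x.2, b = x.1)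
    (h.comp Primrec.snd Primrec.fst) fun x => ?_
  simp

theorem primrec_reduceExponent :
    Primrec fun x : (ℕ × ℕ) × ℕ => reduceExponent x.1.1 x.1.2 x.2 := by
  have hP : Primrec fun x : (ℕ × ℕ) × ℕ => x.1.1 := Primrec.fst.comp Primrec.fst
  have hQ : Primrec fun x : (ℕ × ℕ) × ℕ => x.1.2 := Primrec.snd.comp Primrec.fst
  exact Primrec.ite (Primrec.nat_lt.comp Primrec.snd hP) Primrec.snd
    (Primrec.nat_add.comp hP (Primrec.nat_mod.comp (Primrec.nat_sub.comp Primrec.snd hP) hQ))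

theorem primrec_reduceCode :
    Primrec₂ fun (x : ℕ × ℕ) (s : ℕ × ℕ) => reduceCode x.1 x.2 s :=
  Primrec.pair (Primrec.fst.comp Primrec.snd)
    (primrec_reduceExponent.comp (Primrec.pair Primrec.fst (Primrec.snd.comp Primrec.snd)))

namespace MonogenicCover

variable {M : Type*} [Monoid M] {n : ℕ} {c : ℕ → M}

/-- Right multiplication by finitely many fixed elements is primitive recursive in terms of
components and exponents. -/
theorem exists_primrec_step (C : MonogenicCover n c) {m : ℕ} (g : Fin m → M)
    (hg : ∀ a, g a ≠ 1) :
    ∃ step : ℕ × ℕ → Fin m → ℕ × ℕ, Primrec₂ step ∧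
      ∀ s a, s.1 < n → step s a = code n c (c s.1 ^ s.2 * g a) := by
  obtain ⟨N, hN⟩ := (eventually_all.2 fun a : Fin m => eventually_all.2 fun i : Fin n =>
    C.eventually_component_eq (c i) (hg a)).exists
  set q := N.factorial with hq
  have hq0 : 0 < q := Nat.factorial_pos _
  have hD : ∀ (a : Fin m) (i t : ℕ), ∃ D, i < n → N ≤ t → ∀ k,
      code n c (c i ^ (t + k * q) * g a) =
        ((code n c (c i ^ t * g a)).1, (code n c (c i ^ t * g a)).2 + k * D) := by
    intro a i t
    by_cases h : i < n ∧ N ≤ t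
    · obtain ⟨D, hD⟩ := C.exists_linear_code (hg a) (hN a ⟨i, h.1⟩ t h.2)
      exact ⟨D, fun _ _ => hD⟩
    -- This slope is harmless: an exponent below $N$ is its own representative, so the slope gets
    -- multiplied by $0$.
    · exact ⟨0, fun h1 h2 => absurd ⟨h1, h2⟩ h⟩
  choose D hD using hD
  set table : Fin m → List (List ((ℕ × ℕ) × ℕ)) := fun a =>
    (List.range n).map fun i => (List.range (N + q)).map fun t =>
      (code n c (c i ^ t * g a), D a i t) with htable
  have htab : Primrec table := Primrec.dom_finite _
  have hred : Primrec fun x : (ℕ × ℕ) × Fin m => reduceExponent N q x.1.2 :=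
    primrec_reduceExponent.comp
      (Primrec.pair (Primrec.const (N, q)) (Primrec.snd.comp Primrec.fst))
  have hentry : Primrec fun x : (ℕ × ℕ) × Fin m =>
      ((table x.2).getD x.1.1 []).getD (reduceExponent N q x.1.2) ((0, 0), 0) :=
    (Primrec.list_getD _).comp
      ((Primrec.list_getD _).comp (htab.comp Primrec.snd) (Primrec.fst.comp Primrec.fst)) hred
  refine ⟨fun s a => (fun z : (ℕ × ℕ) × ℕ =>
    (z.1.1, z.1.2 + (s.2 - reduceExponent N q s.2) / q * z.2))
      (((table a).getD s.1 []).getD (reduceExponent N q s.2) ((0, 0), 0)), ?_, ?_⟩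
  · refine Primrec.pair (Primrec.fst.comp (Primrec.fst.comp hentry))
      (Primrec.nat_add.comp (Primrec.snd.comp (Primrec.fst.comp hentry))
        (Primrec.nat_mul.comp (Primrec.nat_div.comp (Primrec.nat_sub.comp
          (Primrec.snd.comp Primrec.fst) hred) (Primrec.const q)) (Primrec.snd.comp hentry)))
  · rintro ⟨i, j⟩ a hi
    obtain ⟨k, hk, hk'⟩ := exists_eq_reduceExponent_add N q j
    have hlt := reduceExponent_lt (P := N) hq0 j
    simp only at hi ⊢
    generalize reduceExponent N q j = t at hk hk' hlt
    have hdiv : (j - t) / q = k := by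
      rw [hk, Nat.add_sub_cancel_left, Nat.mul_div_cancel_left _ hq0]
    have hget : ((table a).getD i []).getD t ((0, 0), 0)
        = (code n c (c i ^ t * g a), D a i t) := by
      simp [htable, hi, hlt, List.getD_eq_getElem?_getD]
    rw [hget, hdiv, hk, mul_comm q k]
    rcases hk' with ht | rfl
    · exact (hD a i t hi ht k).symm
    · simp

/-- Iterating right multiplication along a nonempty list multiplies by the product of the list. -/
theorem foldl_eq_code (C : MonogenicCover n c) {β : Type*} {f : ℕ × ℕ → β → ℕ × ℕ} {g : β → M}
    (hg : ∀ b, g b ≠ 1) (hf : ∀ s b, s.1 < n → f s b = code n c (c s.1 ^ s.2 * g b)) :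
    ∀ (l : List β) (s : ℕ × ℕ), s.1 < n → l ≠ [] →
      l.foldl f s = code n c (c s.1 ^ s.2 * (l.map g).prod)
  | [], _, _, h => absurd rfl h
  | [b], s, hs, _ => by simpa using hf s b hs
  | b :: b' :: l, s, hs, _ => by
    have h := C.code_spec (C.mul_ne_one_right (c s.1 ^ s.2) (g b) (hg b))
    rw [List.foldl_cons, hf s b hs, foldl_eq_code C hg hf (b' :: l) _ h.1 (by simp), h.2.2]
    simp only [List.map_cons, List.prod_cons, mul_assoc]

end MonogenicCover

/-! ### Passage from $S$ to `WithOne S`. -/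

theorem exists_monogenicCover {S : Type*} [Semigroup S]
    (hS : IsFiniteDisjointUnionOfFreeMonogenic S) :
    ∃ (n : ℕ) (c : ℕ → WithOne S), MonogenicCover n c := by
  obtain ⟨n, N, hiso, hdisj, hcov⟩ := hS
  have e := fun i => (hiso i).some
  set c : ℕ → WithOne S := fun i =>
    if h : i < n then (((e ⟨i, h⟩).symm (Multiplicative.ofAdd 1) : N ⟨i, h⟩) : S) else 1 with hc
  have hpow : ∀ (i : Fin n) (j : ℕ+),
      c i ^ (j : ℕ) = (((e i).symm (Multiplicative.ofAdd j) : N i) : S) := by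
    intro i j
    have hci : c i = (((e i).symm (Multiplicative.ofAdd 1) : N i) : S) := by simp [hc]
    induction j using PNat.recOn with
    | one => simpa using hci
    | succ j ih =>
      rw [PNat.add_coe, PNat.one_coe, pow_succ, ih, hci, ← WithOne.coe_mul, ofAdd_add, map_mul]
      rfl
  refine ⟨n, c, ⟨?_, ?_, ?_, ?_⟩⟩
  · intro x hx
    obtain ⟨s, rfl⟩ := WithOne.ne_one_iff_exists.1 hx
    obtain ⟨i, hi⟩ := Set.mem_iUnion.1 (hcov.symm ▸ Set.mem_univ s)
    refine ⟨i, i.2, _, (Multiplicative.toAdd (e i ⟨s, hi⟩)).pos, ?_⟩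
    rw [hpow i]
    simp
  · intro i k j l hi hk hj h
    have h1 := hpow ⟨i, hi⟩ ⟨j, hj⟩
    simp only [PNat.mk_coe] at h1
    rcases Nat.eq_zero_or_pos l with rfl | hl
    · rw [pow_zero, h1] at h
      exact absurd h WithOne.coe_ne_one
    · have h2 := hpow ⟨k, hk⟩ ⟨l, hl⟩
      simp only [PNat.mk_coe] at h2
      rw [h1, h2, WithOne.coe_inj] at h
      have hik : i = k := by
        by_contra hne
        have hmem := ((e ⟨k, hk⟩).symm (Multiplicative.ofAdd ⟨l, hl⟩)).2
        rw [← h] at hmem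
        exact Set.disjoint_left.1 (hdisj ⟨i, hi⟩ ⟨k, hk⟩ (by simpa using hne))
          ((e ⟨i, hi⟩).symm (Multiplicative.ofAdd ⟨j, hj⟩)).2 hmem
      subst hik
      have h3 := (e ⟨i, hi⟩).symm.injective (Subtype.ext h)
      exact ⟨rfl, congrArg PNat.val (Multiplicative.ofAdd.injective h3)⟩
  · intro x y hx
    obtain ⟨s, rfl⟩ := WithOne.ne_one_iff_exists.1 hx
    refine WithOne.cases_on y (by simp) fun t => ?_
    rw [← WithOne.coe_mul]
    exact WithOne.coe_ne_one
  · intro x y hy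
    obtain ⟨s, rfl⟩ := WithOne.ne_one_iff_exists.1 hy
    refine WithOne.cases_on x (by simp) fun t => ?_
    rw [← WithOne.coe_mul]
    exact WithOne.coe_ne_one

theorem WithOne.coe_foldl_mul {S α : Type*} [Semigroup S] (g : α → S) (l : List α) (s : S) :
    ((l.foldl (fun t a => t * g a) s : S) : WithOne S)
      = s * (l.map fun a => (g a : WithOne S)).prod := by
  induction l generalizing s with
  | nil => simp
  | cons b l ih => simp [ih, mul_assoc]

theorem NEWord.coe_eval {S : Type*} [Semigroup S] {m : ℕ} (g : Fin m → S) (w : NEWord m) :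
    ((NEWord.eval g w : S) : WithOne S)
      = ((w.1 :: w.2).map fun a => (g a : WithOne S)).prod :=
  WithOne.coe_foldl_mul g w.2 (g w.1)

/-! ### Finite certificates for membership and non-membership. -/

/-- The set of elements whose component and exponent, reduced with index `P` and period `Q`, lie in
`L` contains the elements coded by `Y` and is closed under right multiplication by them, but does
not contain the element coded by `x`. The function `run` gives right multiplication in terms of
components and exponents; its results are periodic with index `p` and period `q` after reduction,
so that finitely many instances suffice. -/
def Separates {β : Type*} (n : ℕ) (run : ℕ × ℕ → β → ℕ × ℕ) (Y : List β) (x : β)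
    (P Q p q : ℕ) (L : List (ℕ × ℕ)) : Prop :=
  P ≤ p ∧ 0 < q ∧ q % Q = 0 ∧
  (∀ y ∈ Y, reduceCode P Q (run (0, 0) y) ∈ L ∧
    (∀ i < n, ∀ t < p + q, reduceCode P Q (i, t) ∈ L → reduceCode P Q (run (i, t) y) ∈ L) ∧
    (∀ i < n, ∀ t < q, reduceCode P Q (run (i, p + t) y)
      = reduceCode P Q (run (i, p + t + q) y))) ∧
  reduceCode P Q (run (0, 0) x) ∉ L

section

variable {S β : Type*} [Semigroup S] {n : ℕ} {c : ℕ → WithOne S}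
  {run : ℕ × ℕ → β → ℕ × ℕ} {v : β → S} {Y : List β} {x : β}

theorem Separates.notMem_closure {P Q p q : ℕ} {L : List (ℕ × ℕ)} (C : MonogenicCover n c)
    (hn : 0 < n)
    (hrun : ∀ s b, s.1 < n → run s b = MonogenicCover.code n c (c s.1 ^ s.2 * v b))
    (h : Separates n run Y x P Q p q L) :
    v x ∉ Subsemigroup.closure {s : S | ∃ y ∈ Y, v y = s} := by
  obtain ⟨hPp, hq, hQq, hY, hx⟩ := h
  have hQq := Nat.dvd_of_mod_eq_zero hQq
  have hrun0 : ∀ y, run (0, 0) y = MonogenicCover.code n c (v y) := fun y => by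
    simpa using hrun (0, 0) y hn
  set A : Set S := {s | reduceCode P Q (MonogenicCover.code n c s) ∈ L} with hA
  have hstep : ∀ y ∈ Y, ∀ s ∈ A, s * v y ∈ A := by
    intro y hy s hs
    obtain ⟨hi, hj, e⟩ := C.code_spec (WithOne.coe_ne_one (a := s))
    simp only [hA, Set.mem_ofPred_eq] at hs ⊢
    rw [WithOne.coe_mul, ← e]
    rw [← e, C.code_pow hi hj] at hs
    generalize (MonogenicCover.code n c s).1 = i at *
    generalize (MonogenicCover.code n c s).2 = j at *
    rw [← hrun (i, j) y hi]
    obtain ⟨k, hk, hk'⟩ := exists_eq_reduceExponent_add p q j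
    have hlt := reduceExponent_lt (P := p) hq j
    generalize reduceExponent p q j = t at hk hk' hlt
    rcases hk' with ht | rfl
    · have h1 : reduceCode P Q (i, j) = reduceCode P Q (i, t) := by
        simp only [reduceCode, hk]
        rw [reduceExponent_add_dvd (hPp.trans ht) (hQq.mul_right k)]
      have h2 := (hY y hy).2.2 i hi (t - p) (by omega)
      -- One periodicity instance shows that the results at $t$ and $t + q$ share a component, which
      -- makes the exponents linear with slope $D$, and that adding $D$ once keeps the reduced
      -- exponent; hence so does adding $kD$.
      rw [Nat.add_sub_cancel' ht, hrun _ _ hi, hrun _ _ hi] at h2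
      obtain ⟨D, hD⟩ := C.exists_linear_code (WithOne.coe_ne_one (a := v y))
        (congrArg Prod.fst h2).symm
      have hD1 := hD 1
      rw [one_mul, one_mul] at hD1
      simp only at h2
      rw [hD1] at h2
      have h3 := reduceExponent_add_step (congrArg Prod.snd h2).symm k
      have h4 : reduceCode P Q (run (i, j) y) = reduceCode P Q (run (i, t) y) := by
        rw [hrun _ _ hi, hrun _ _ hi, hk, mul_comm q k]
        simp only
        rw [hD k]
        exact Prod.ext rfl h3
      rw [h4]
      exact (hY y hy).2.1 i hi t hlt (h1 ▸ hs)
    · rw [mul_zero, add_zero] at hk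
      exact (hY y hy).2.1 i hi j (hk ▸ hlt) hs
  -- $A$ itself need not be a subsemigroup; its elements that also preserve $A$ from the right form
  -- one.
  let B : Subsemigroup S :=
    { carrier := {t | t ∈ A ∧ ∀ s ∈ A, s * t ∈ A}
      mul_mem' := fun {a b} ha hb =>
        ⟨hb.2 a ha.1, fun s hs => by rw [← mul_assoc]; exact hb.2 _ (ha.2 s hs)⟩ }
  have hB : Subsemigroup.closure {s : S | ∃ y ∈ Y, v y = s} ≤ B := by
    refine Subsemigroup.closure_le.2 ?_
    rintro _ ⟨y, hy, rfl⟩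
    refine ⟨?_, hstep y hy⟩
    have := (hY y hy).1
    rwa [hrun0] at this
  intro hmem
  have := (hB hmem).1
  rw [hrun0] at hx
  exact hx this

theorem exists_separates (C : MonogenicCover n c) (hn : 0 < n)
    (hrun : ∀ s b, s.1 < n → run s b = MonogenicCover.code n c (c s.1 ^ s.2 * v b))
    (h : v x ∉ Subsemigroup.closure {s : S | ∃ y ∈ Y, v y = s}) :
    ∃ P Q p q L, Separates n run Y x P Q p q L := by
  classical
  have hrun0 : ∀ y, run (0, 0) y = MonogenicCover.code n c (v y) := fun y => by
    simpa using hrun (0, 0) y hn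
  set T := Subsemigroup.closure {s : S | ∃ y ∈ Y, v y = s} with hT
  set A : ℕ → Set ℕ := fun i => {j | ∃ s ∈ T, (s : WithOne S) = c i ^ j} with hA
  have hper : ∀ i : Fin n, ∀ᶠ N in atTop, ∀ j ≥ N, (j ∈ A i ↔ j + N.factorial ∈ A i) := by
    refine fun i => eventually_mem_add_factorial_iff _ ?_
    rintro j ⟨s, hs, hsj⟩ k ⟨t, ht, htk⟩
    exact ⟨s * t, T.mul_mem hs ht, by rw [WithOne.coe_mul, hsj, htk, pow_add]⟩
  obtain ⟨P, hP⟩ := (eventually_all.2 hper).exists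
  set Q := P.factorial with hQ
  have hQ0 : 0 < Q := Nat.factorial_pos P
  have hred : ∀ i < n, ∀ j, j ∈ A i ↔ reduceExponent P Q j ∈ A i := by
    intro i hi j
    have hmul : ∀ k, ∀ t ≥ P, t ∈ A i ↔ t + Q * k ∈ A i := by
      intro k
      induction k with
      | zero => simp
      | succ k ih =>
        intro t ht
        rw [ih t ht, hP ⟨i, hi⟩ _ (by omega), mul_add, mul_one, add_assoc]
    obtain ⟨k, hk, hk'⟩ := exists_eq_reduceExponent_add P Q j
    rcases hk' with ht | rfl
    · conv_lhs => rw [hk]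
      exact (hmul k _ ht).symm
    · rw [mul_zero, add_zero] at hk
      rw [← hk]
  -- Reduction respects membership in $T$, so these finitely many pairs determine $T$ exactly.
  set L := ((List.range n).product (List.range (P + Q))).filter fun s => s.2 ∈ A s.1 with hL
  have hmemL : ∀ s : ℕ × ℕ, s.1 < n → (reduceCode P Q s ∈ L ↔ s.2 ∈ A s.1) := by
    rintro ⟨i, j⟩ hi
    simp only [hL, reduceCode, List.mem_filter, List.pair_mem_product, List.mem_range,
      decide_eq_true_eq]
    rw [hred i hi j]
    exact and_iff_right ⟨hi, reduceExponent_lt hQ0 j⟩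
  have hcode : ∀ s : S, reduceCode P Q (MonogenicCover.code n c s) ∈ L ↔ s ∈ T := by
    intro s
    obtain ⟨hi, hj, e⟩ := C.code_spec (WithOne.coe_ne_one (a := s))
    rw [hmemL _ hi]
    constructor
    · rintro ⟨t, ht, hts⟩
      rw [e, WithOne.coe_inj] at hts
      rwa [← hts]
    · intro hs
      exact ⟨s, hs, e.symm⟩
  have hpq : ∀ᶠ N in atTop, ∀ y ∈ Y, ∀ i : Fin n, ∀ j ≥ N,
      reduceCode P Q (MonogenicCover.code n c (c i ^ (j + N.factorial) * v y)) =
        reduceCode P Q (MonogenicCover.code n c (c i ^ j * v y)) := by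
    have := (eventually_all_finset Y.toFinset).2 fun y _ => eventually_all.2 fun i : Fin n =>
      C.eventually_reduceCode_eq (c i) (WithOne.coe_ne_one (a := v y)) P hQ0
    simpa using this
  -- Taking $p \ge Q$ makes the period $p!$ divisible by $Q$.
  obtain ⟨p, hp, hpP, hpQ⟩ :=
    (hpq.and ((eventually_ge_atTop P).and (eventually_ge_atTop Q))).exists
  refine ⟨P, Q, p, p.factorial, L, hpP, Nat.factorial_pos p,
    Nat.mod_eq_zero_of_dvd (Nat.dvd_factorial hQ0 hpQ), fun y hy => ⟨?_, ?_, ?_⟩, ?_⟩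
  · rw [hrun0, hcode]
    exact Subsemigroup.subset_closure ⟨y, hy, rfl⟩
  · intro i hi t _ ht
    rw [hmemL _ hi] at ht
    obtain ⟨s, hs, hst⟩ := ht
    rw [hrun _ _ hi]
    simp only at hst ⊢
    rw [← hst, ← WithOne.coe_mul, hcode]
    exact T.mul_mem hs (Subsemigroup.subset_closure ⟨y, hy, rfl⟩)
  · intro i hi t _
    rw [hrun _ _ hi, hrun _ _ hi]
    exact (hp y hy ⟨i, hi⟩ (p + t) (by omega)).symm
  · rwa [hrun0, hcode]

/-- Membership in the closure is witnessed by a list of generators. -/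
theorem mem_closure_iff_exists_foldl (C : MonogenicCover n c) (hn : 0 < n)
    (hrun : ∀ s b, s.1 < n → run s b = MonogenicCover.code n c (c s.1 ^ s.2 * v b)) :
    v x ∈ Subsemigroup.closure {s : S | ∃ y ∈ Y, v y = s} ↔
      ∃ l : List β, (∀ y ∈ l, y ∈ Y) ∧ l.foldl run (0, 0) = run (0, 0) x := by
  have hrun0 : run (0, 0) x = MonogenicCover.code n c (v x) := by
    simpa using hrun (0, 0) x hn
  have hfold : ∀ l : List β, l ≠ [] →
      l.foldl run (0, 0) = MonogenicCover.code n c (l.map fun b => (v b : WithOne S)).prod := by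
    intro l hl
    have := C.foldl_eq_code (g := fun b => (v b : WithOne S)) (fun _ => WithOne.coe_ne_one)
      hrun l (0, 0) hn hl
    simpa using this
  constructor
  · intro h
    have key : ∀ s ∈ Subsemigroup.closure {s : S | ∃ y ∈ Y, v y = s},
        ∃ l : List β, l ≠ [] ∧ (∀ y ∈ l, y ∈ Y) ∧
          (l.map fun b => (v b : WithOne S)).prod = s := by
      intro s hs
      induction hs using Subsemigroup.closure_induction with
      | mem s hs =>
        obtain ⟨y, hy, rfl⟩ := hs
        exact ⟨[y], by simp, by simpa using hy, by simp⟩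
      | mul s t _ _ hs ht =>
        obtain ⟨l, hl, hlY, hls⟩ := hs
        obtain ⟨l', _, hlY', hlt⟩ := ht
        refine ⟨l ++ l', by simp [hl], ?_, by simp [hls, hlt]⟩
        intro y hy
        exact (List.mem_append.1 hy).elim (hlY y) (hlY' y)
    obtain ⟨l, hl, hlY, hlx⟩ := key _ h
    exact ⟨l, hlY, by rw [hfold l hl, hlx, hrun0]⟩
  · rintro ⟨l, hlY, hlx⟩
    have hx := C.code_spec (WithOne.coe_ne_one (a := v x))
    rw [hrun0] at hlx
    -- The empty list stays at `(0, 0)`, the code of $1$; elements of $S$ have positive exponent, so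
    -- it is no witness.
    rcases l with _ | ⟨b, l⟩
    · rw [List.foldl_nil] at hlx
      have := hx.2.1
      rw [← hlx] at this
      omega
    · have hprod : (((b :: l).map fun b => (v b : WithOne S)).prod)
          = ((l.foldl (fun t y => t * v y) (v b) : S) : WithOne S) := by
        rw [WithOne.coe_foldl_mul, List.map_cons, List.prod_cons]
      rw [hfold _ (by simp), hprod] at hlx
      have h1 := C.code_spec
        (WithOne.coe_ne_one (a := l.foldl (fun t y => t * v y) (v b)))
      rw [hlx] at h1
      have h2 := WithOne.coe_injective (h1.2.2.symm.trans hx.2.2)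
      rw [← h2]
      have hgen : ∀ y ∈ Y, v y ∈ Subsemigroup.closure {s : S | ∃ y ∈ Y, v y = s} :=
        fun y hy => Subsemigroup.subset_closure ⟨y, hy, rfl⟩
      exact List.foldlRecOn l _ (hgen b (hlY b (by simp))) fun s hs y hy =>
        Subsemigroup.mul_mem _ hs (hgen y (hlY y (by simp [hy])))

end

/-! ### Certificates are primitive recursively checkable; the decision procedure. -/

section

variable {α : Type*} [Primcodable α] {κ : α → ((ℕ × ℕ) × (ℕ × ℕ)) × List (ℕ × ℕ)}
  {s t : α → ℕ × ℕ}

theorem primrec_reduceCode_comp (hκ : Primrec κ) (hs : Primrec s) :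
    Primrec fun a => reduceCode (κ a).1.1.1 (κ a).1.1.2 (s a) :=
  primrec_reduceCode.comp (Primrec.fst.comp (Primrec.fst.comp hκ)) hs

theorem primrecPred_reduceCode_mem (hκ : Primrec κ) (hs : Primrec s) :
    PrimrecPred fun a => reduceCode (κ a).1.1.1 (κ a).1.1.2 (s a) ∈ (κ a).2 :=
  primrecRel_mem_list.comp (primrec_reduceCode_comp hκ hs) (Primrec.snd.comp hκ)

theorem PrimrecPred.imp {p q : α → Prop} (hp : PrimrecPred p) (hq : PrimrecPred q) :
    PrimrecPred fun a => p a → q a := by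
  classical
  exact (hp.not.or hq).of_eq fun a => imp_iff_not_or.symm

theorem PrimrecPred.forall_lt_comp {R : α → ℕ → Prop} {f : α → ℕ}
    (hR : PrimrecPred fun z : ℕ × α => R z.2 z.1) (hf : Primrec f) :
    PrimrecPred fun a => ∀ k < f a, R a k :=
  ((PrimrecRel.forall_mem_list (R := fun k a => R a k) hR).comp
    (Primrec.list_range.comp hf) Primrec.id).of_eq fun a => by simp

end

theorem primrecPred_separates {β : Type*} [Primcodable β] (n : ℕ) {run : ℕ × ℕ → β → ℕ × ℕ}
    (hrun : Primrec₂ run) :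
    PrimrecPred fun z : (List β × β) × ((ℕ × ℕ) × (ℕ × ℕ)) × List (ℕ × ℕ) =>
      Separates n run z.1.1 z.1.2 z.2.1.1.1 z.2.1.1.2 z.2.1.2.1 z.2.1.2.2 z.2.2 := by
  have hκ : Primrec fun z : (List β × β) × ((ℕ × ℕ) × (ℕ × ℕ)) × List (ℕ × ℕ) => z.2 :=
    Primrec.snd
  have hP := Primrec.fst.comp (Primrec.fst.comp (Primrec.fst.comp hκ))
  have hQ := Primrec.snd.comp (Primrec.fst.comp (Primrec.fst.comp hκ))
  have hp := Primrec.fst.comp (Primrec.snd.comp (Primrec.fst.comp hκ))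
  have hq := Primrec.snd.comp (Primrec.snd.comp (Primrec.fst.comp hκ))
  have hx : Primrec fun z : (List β × β) × ((ℕ × ℕ) × (ℕ × ℕ)) × List (ℕ × ℕ) =>
      run (0, 0) z.1.2 := hrun.comp (Primrec.const _) (Primrec.snd.comp Primrec.fst)
  refine (Primrec.nat_le.comp hP hp).and ((Primrec.nat_lt.comp (Primrec.const 0) hq).and
    ((Primrec.eq.comp (Primrec.nat_mod.comp hq hQ) (Primrec.const 0)).and (PrimrecPred.and ?_
      (primrecPred_reduceCode_mem hκ hx).not)))
  refine (PrimrecRel.forall_mem_list (R := fun (y : β)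
    (w : ((ℕ × ℕ) × (ℕ × ℕ)) × List (ℕ × ℕ)) =>
      reduceCode w.1.1.1 w.1.1.2 (run (0, 0) y) ∈ w.2 ∧
      (∀ i < n, ∀ t < w.1.2.1 + w.1.2.2, reduceCode w.1.1.1 w.1.1.2 (i, t) ∈ w.2 →
        reduceCode w.1.1.1 w.1.1.2 (run (i, t) y) ∈ w.2) ∧
      (∀ i < n, ∀ t < w.1.2.2, reduceCode w.1.1.1 w.1.1.2 (run (i, w.1.2.1 + t) y)
        = reduceCode w.1.1.1 w.1.1.2 (run (i, w.1.2.1 + t + w.1.2.2) y))) ?_).comp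
    (Primrec.fst.comp Primrec.fst) hκ
  have hq₁ : Primrec fun z : ℕ × β × ((ℕ × ℕ) × (ℕ × ℕ)) × List (ℕ × ℕ) => z.2.2.1.2.2 :=
    Primrec.snd.comp (Primrec.snd.comp (Primrec.fst.comp (Primrec.snd.comp Primrec.snd)))
  have hp₁ : Primrec fun z : ℕ × β × ((ℕ × ℕ) × (ℕ × ℕ)) × List (ℕ × ℕ) => z.2.2.1.2.1 :=
    Primrec.fst.comp (Primrec.snd.comp (Primrec.fst.comp (Primrec.snd.comp Primrec.snd)))
  have hκ₂ : Primrec fun z : ℕ × ℕ × β × ((ℕ × ℕ) × (ℕ × ℕ)) × List (ℕ × ℕ) => z.2.2.2 :=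
    Primrec.snd.comp (Primrec.snd.comp Primrec.snd)
  have hy₂ : Primrec fun z : ℕ × ℕ × β × ((ℕ × ℕ) × (ℕ × ℕ)) × List (ℕ × ℕ) => z.2.2.1 :=
    Primrec.fst.comp (Primrec.snd.comp Primrec.snd)
  have hi₂ : Primrec fun z : ℕ × ℕ × β × ((ℕ × ℕ) × (ℕ × ℕ)) × List (ℕ × ℕ) => z.2.1 :=
    Primrec.fst.comp Primrec.snd
  have ht₂ : Primrec fun z : ℕ × ℕ × β × ((ℕ × ℕ) × (ℕ × ℕ)) × List (ℕ × ℕ) => z.1 :=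
    Primrec.fst
  have hpt := Primrec.nat_add.comp (hp₁.comp Primrec.snd) ht₂
  have hptq := Primrec.nat_add.comp hpt (hq₁.comp Primrec.snd)
  refine PrimrecPred.and (primrecPred_reduceCode_mem Primrec.snd
    (hrun.comp (Primrec.const _) Primrec.fst)) (PrimrecPred.and ?_ ?_)
  · refine PrimrecPred.forall_lt_comp (PrimrecPred.forall_lt_comp ?_
      (Primrec.nat_add.comp hp₁ hq₁)) (Primrec.const n)
    exact (primrecPred_reduceCode_mem hκ₂ (Primrec.pair hi₂ ht₂)).imp
      (primrecPred_reduceCode_mem hκ₂ (hrun.comp (Primrec.pair hi₂ ht₂) hy₂))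
  · refine PrimrecPred.forall_lt_comp (PrimrecPred.forall_lt_comp ?_ hq₁) (Primrec.const n)
    exact Primrec.eq.comp
      (primrec_reduceCode_comp hκ₂ (hrun.comp (Primrec.pair hi₂ hpt) hy₂))
      (primrec_reduceCode_comp hκ₂ (hrun.comp (Primrec.pair hi₂ hptq) hy₂))

theorem computablePred_mem_closure {S β : Type*} [Semigroup S] [Primcodable β] {n : ℕ}
    {c : ℕ → WithOne S} (C : MonogenicCover n c) (hn : 0 < n) {run : ℕ × ℕ → β → ℕ × ℕ}
    (hprim : Primrec₂ run) {v : β → S}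
    (hrun : ∀ s b, s.1 < n → run s b = MonogenicCover.code n c (c s.1 ^ s.2 * v b)) :
    ComputablePred fun p : List β × β =>
      v p.2 ∈ Subsemigroup.closure {s : S | ∃ y ∈ p.1, v y = s} := by
  classical
  refine ComputablePred.computable_iff_re_compl_re.2 ⟨?_, ?_⟩
  · have hmem : PrimrecPred fun z : (List β × β) × List β => ∀ y ∈ z.2, y ∈ z.1.1 :=
      (PrimrecRel.forall_mem_list primrecRel_mem_list).comp Primrec.snd
        (Primrec.fst.comp Primrec.fst)
    have hrun0 : Primrec fun z : (List β × β) × List β => run (0, 0) z.1.2 :=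
      hprim.comp (Primrec.const _) (Primrec.snd.comp Primrec.fst)
    have hfold : Primrec fun z : (List β × β) × List β => z.2.foldl run (0, 0) :=
      Primrec.list_foldl Primrec.snd (Primrec.const _)
        (hprim.comp (Primrec.fst.comp Primrec.snd) (Primrec.snd.comp Primrec.snd)).to₂
    exact (REPred.exists_of_primrecPred (hmem.and (Primrec.eq.comp hfold hrun0))).of_eq
      fun p => (mem_closure_iff_exists_foldl (Y := p.1) (x := p.2) C hn hrun).symm
  · refine (REPred.exists_of_primrecPred (primrecPred_separates n hprim)).of_eq fun p => ?_
    constructor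
    · rintro ⟨z, hz⟩
      exact hz.notMem_closure C hn hrun
    · intro h
      obtain ⟨P, Q, p', q', L, h'⟩ := exists_separates C hn hrun h
      exact ⟨(((P, Q), (p', q')), L), h'⟩

theorem MonogenicCover.exists_closure_range_eq_top {S : Type*} [Semigroup S] {n : ℕ}
    {c : ℕ → WithOne S} (C : MonogenicCover n c) :
    ∃ g : Fin n → S, Subsemigroup.closure (Set.range g) = ⊤ := by
  have hc : ∀ i : Fin n, ∃ s : S, (s : WithOne S) = c i := fun i =>
    WithOne.ne_one_iff_exists.1 (by simpa using C.pow_ne_one i.2 le_rfl)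
  choose g hg using hc
  refine ⟨g, eq_top_iff.2 fun s _ => ?_⟩
  obtain ⟨i, hi, j, hj, e⟩ := C.exists_pow s WithOne.coe_ne_one
  obtain ⟨j, rfl⟩ := Nat.exists_eq_add_of_le' hj
  have hgi : g ⟨i, hi⟩ ∈ Subsemigroup.closure (Set.range g) :=
    Subsemigroup.subset_closure ⟨_, rfl⟩
  induction j generalizing s with
  | zero =>
    rw [zero_add, pow_one, ← hg ⟨i, hi⟩, WithOne.coe_inj] at e
    rwa [← e]
  | succ j ih =>
    obtain ⟨t, ht⟩ := WithOne.ne_one_iff_exists.1 (C.pow_ne_one (j := j + 1) hi (by omega))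
    rw [pow_succ, ← ht, ← hg ⟨i, hi⟩, ← WithOne.coe_mul, WithOne.coe_inj] at e
    rw [← e]
    exact Subsemigroup.mul_mem _ (ih t trivial (by omega) ht.symm) hgi

theorem theorem3p6 (S : Type*) [Semigroup S] (hS : IsFiniteDisjointUnionOfFreeMonogenic S) :
    HasSolubleSubsemigroupMembership S := by
  obtain ⟨n, c, C⟩ := exists_monogenicCover hS
  refine ⟨⟨n, C.exists_closure_range_eq_top⟩, fun m g _ => ?_⟩
  rcases Nat.eq_zero_or_pos n with rfl | hn
  -- With no components $S$ is empty and there are no words. Otherwise $0 < n$ makes `(0, 0)` a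
  -- legitimate initial state, since $c_0^0 = 1$.
  · have hp : (fun p : List (NEWord m) × NEWord m => NEWord.eval g p.2 ∈
        Subsemigroup.closure {s : S | ∃ y ∈ p.1, NEWord.eval g y = s}) = fun _ => True := by
      funext p
      obtain ⟨i, hi, -⟩ := C.exists_pow (NEWord.eval g p.2 : S) WithOne.coe_ne_one
      exact absurd hi (Nat.not_lt_zero i)
    rw [hp]
    exact ComputablePred.computable_iff.2 ⟨fun _ => true, Computable.const true, by simp⟩
  obtain ⟨step, hstep, hcode⟩ := C.exists_primrec_step (fun a => (g a : WithOne S))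
    (fun _ => WithOne.coe_ne_one)
  refine computablePred_mem_closure C hn
    (run := fun s w => (w.1 :: w.2).foldl step s) ?_ fun s w hs => ?_
  · exact Primrec.list_foldl
      (Primrec.list_cons.comp (Primrec.fst.comp Primrec.snd) (Primrec.snd.comp Primrec.snd))
      Primrec.fst
      (hstep.comp (Primrec.fst.comp Primrec.snd) (Primrec.snd.comp Primrec.snd)).to₂
  · rw [NEWord.coe_eval]
    exact C.foldl_eq_code (fun _ => WithOne.coe_ne_one) hcode _ s hs (by simp)
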